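/- Let $G=(V,E)$ be a finite simple undirected graph. For an integer $k\ge 1$, a \emph{random $k$-out subgraph} of $G$ is the graph $(V,S)$ obtained as follows: independently, each vertex $v$ chooses a uniformly random set of $\min\{k,\deg(v)\}$ of its incident edges, and $S$ is the set of edges chosen by at least one of their endpoints. For a real number $k>0$, a \emph{random expected $k$-out subgraph} of $G$ is the graph $(V,S)$ obtained as follows: each vertex $v$ samples each of its incident edges with probability $k/\max\{k,\deg(v)\}$, all these samplings (including those of the same edge by its two endpoints) being independent, and $S$ is the set of edges sampled by at least one of their endpoints. For a real number $r>0$, $G$ is \emph{$r$-edge-connected} if it remains connected after the deletion of any set of fewer than $r$ edges. There is an absolute constant $c_0>0$ such that for every real $c\ge c_0$ the following holds. Let $G$ be a simple graph on $n\ge 1$ vertices, let $k\ge c\log n$ (with $k\ge 1$ an integer in the $k$-out model and $k>0$ real in the expected $k$-out model), and suppose that $G$ is $(cn/k)$-edge-connected. Let $G'$ be a random $k$-out subgraph or a random expected $k$-out subgraph of $G$. Then, in either model, $G'$ is connected with probability at least $1/2$. -/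

import Mathlib

open MeasureTheory
open scoped NNReal ENNReal

namespace RandomKOut

/-- Finite sets of edges carry the discrete σ-algebra. -/
instance instMeasurableSpaceFinsetSym2 (V : Type*) : MeasurableSpace (Finset (Sym2 V)) := ⊤

instance instDiscreteMeasurableSpaceFinsetSym2 (V : Type*) :
    DiscreteMeasurableSpace (Finset (Sym2 V)) := ⟨fun _ => trivial⟩

section

variable {V : Type*} [Fintype V] [DecidableEq V] (G : SimpleGraph V) [DecidableRel G.Adj]

/-- The possible choices of the vertex `v` in the `k`-out model: the sets of exactly
`min k (deg v)` edges incident with `v`. -/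
def choices (k : ℕ) (v : V) : Finset (Finset (Sym2 V)) :=
  (G.incidenceFinset v).powersetCard (min k (G.degree v))

theorem choices_nonempty (k : ℕ) (v : V) : (choices G k v).Nonempty := by
  unfold choices
  rw [Finset.powersetCard_nonempty, SimpleGraph.card_incidenceFinset_eq_degree]
  exact min_le_right _ _

/-- The law of the choices in the `k`-out model: independently over the vertices, each vertex
chooses a uniformly random set of `min k (deg v)` of its incident edges. -/
noncomputable def kOutMeasure (k : ℕ) : Measure (V → Finset (Sym2 V)) :=
  Measure.pi fun v => (PMF.uniformOfFinset (choices G k v) (choices_nonempty G k v)).toMeasure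

/-- The graph formed by the edges that were chosen by at least one vertex. -/
def kOutGraph (ω : V → Finset (Sym2 V)) : SimpleGraph V :=
  SimpleGraph.fromEdgeSet {e | ∃ v, e ∈ ω v}

/-- The probability `k / max {k, deg v}` with which `v` samples each of its incident edges in the
expected `k`-out model. -/
noncomputable def sampleProb (k : ℝ≥0) (v : V) : unitInterval :=
  ⟨(k : ℝ) / max (k : ℝ) (G.degree v : ℝ),
    div_nonneg k.2 (le_max_of_le_left k.2),
    div_le_one_of_le₀ (le_max_left _ _) (le_max_of_le_left k.2)⟩

/-- The law of the samples in the expected `k`-out model. A dart `d` of `G` is an edge together with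
one of its endpoints `d.fst`; independently over the darts, the endpoint `d.fst` samples the edge
with probability `k / max {k, deg d.fst}`. -/
noncomputable def expectedKOutMeasure (k : ℝ≥0) : Measure (G.Dart → Bool) :=
  Measure.pi fun d => ProbabilityTheory.bernoulliMeasure true false (sampleProb G k d.fst)

end

/-- The graph formed by the edges that were sampled by at least one of their endpoints. -/
def expectedKOutGraph {V : Type*} {G : SimpleGraph V} (ω : G.Dart → Bool) : SimpleGraph V :=
  SimpleGraph.fromEdgeSet {e | ∃ d : G.Dart, ω d = true ∧ d.edge = e}

end RandomKOut

/-!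
A `k`-out graph arises from many independent random picks of single edges. Both models dominate
such a process: a random set of `min k (deg v)` incident edges is at least as good as `k` uniform
picks with replacement, and a Bernoulli sample is at least as good as many unlikely picks of the same
edge with the same total rate (`subsetAvg_le_expect`, `lintegral_bernoulli_le_expect`). The
comparison is made one coordinate at a time (`lintegral_pi_le_expect`). Since picks commute, they
can be grouped into three phases, in each of which every edge `uv` is picked at rate at least
`κ / min (deg u) (deg v)`, where `κ = k / 4`. Let `n` be the number of vertices and `r = c * n / k`;
every cut has at least `r` edges, and so every degree is at least `r`.

* After the first phase, no component has fewer than `r / 2` vertices: in a set `A` this small every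
  vertex sends at least half of its edges out of `A`, so that `A` is left isolated with probability
  at most `exp (-κ / 2) ^ card A`, and `k ≥ c log n` pays for the union bound over all `A`
  (`expect_exists_small_le`).
* Hence there are at most `2 * n / r = 2 * k / c` components, and at most `exp (2 * k / c)` unions of
  components. This is few enough for a union bound to show that, after the second phase, each vertex
  `v` lies in a component of at least `deg v / 2` vertices (`expect_exists_degree_gt_le`).
* Let the potential be the sum over the components of the largest degree in the component. It is now
  at most `2 * n`, and it drops by at least `min (deg u) (deg v)` whenever an edge `uv` between two
  components is picked. Every edge that crosses between components at the end has been crossing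
  all along, so the potential would have dropped by `κ` in expectation for every such edge: the
  expected number of crossing edges is at most `2 * n / κ` (`expect_sum_crossing_le`). If the final
  graph is disconnected, at least `r` edges cross, so that Markov's inequality bounds the probability
  of this by `2 * n / (κ * r) = 8 / c` (`expect_not_connected_le_of_comp`).
-/

namespace RandomKOut

/-! ### Independent random picks -/

section PickLaw

variable {α : Type*} [Fintype α]

/-- The law of a single random pick from `α`: the element `a` is picked with probability `prob a`,
and with the remaining probability nothing is picked. -/
structure PickLaw (α : Type*) [Fintype α] where
  /-- The probability that `a` is picked. -/
  prob : α → ℝ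
  prob_nonneg : ∀ a, 0 ≤ prob a
  sum_prob_le_one : ∑ a, prob a ≤ 1

/-- The expected number of times that `a` is picked. -/
def rate (L : Multiset (PickLaw α)) (a : α) : ℝ := (L.map fun π => π.prob a).sum

@[simp] theorem rate_zero (a : α) : rate 0 a = 0 := by simp [rate]

@[simp] theorem rate_cons (π : PickLaw α) (L : Multiset (PickLaw α)) (a : α) :
    rate (π ::ₘ L) a = π.prob a + rate L a := by simp [rate]

theorem rate_add (L M : Multiset (PickLaw α)) (a : α) :
    rate (L + M) a = rate L a + rate M a := by simp [rate]

theorem rate_nonneg (L : Multiset (PickLaw α)) (a : α) : 0 ≤ rate L a :=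
  Multiset.sum_nonneg fun x hx => by
    obtain ⟨π, -, rfl⟩ := Multiset.mem_map.1 hx
    exact π.prob_nonneg a

theorem rate_sum_nsmul {ι : Type*} (s : Finset ι) (m : ℕ) (π : ι → PickLaw α) (a : α) :
    rate (∑ i ∈ s, m • {π i}) a = m * ∑ i ∈ s, (π i).prob a := by
  classical
  induction s using Finset.induction_on with
  | empty => simp
  | insert i s hi ih =>
    rw [Finset.sum_insert hi, Finset.sum_insert hi, rate_add, ih, mul_add]
    simp [rate, Multiset.map_nsmul, Multiset.sum_nsmul]

variable [DecidableEq α]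

/-- The expectation of `F` after one random pick has been added to the set `S`. -/
noncomputable def PickLaw.avg (π : PickLaw α) (F : Finset α → ℝ) (S : Finset α) : ℝ :=
  ∑ a, π.prob a * F (insert a S) + (1 - ∑ a, π.prob a) * F S

theorem PickLaw.avg_comm (π ρ : PickLaw α) (F : Finset α → ℝ) :
    π.avg (ρ.avg F) = ρ.avg (π.avg F) := by
  funext S
  simp only [PickLaw.avg, mul_add, Finset.sum_add_distrib, Finset.mul_sum]
  rw [Finset.sum_comm]
  simp only [Finset.insert_comm, ← mul_assoc, mul_comm]
  have h1 : ∀ (p q : α → ℝ), ∑ x, (1 - ∑ i, q i) * p x * F (insert x S)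
      = ∑ x, p x * (1 - ∑ i, q i) * F (insert x S) := fun p q =>
    Finset.sum_congr rfl fun x _ => by ring
  have h2 : ∑ y, ∑ x, F (insert x (insert y S)) * (π.prob x * ρ.prob y)
      = ∑ y, ∑ x, F (insert x (insert y S)) * (π.prob y * ρ.prob x) := by
    rw [Finset.sum_comm]
    simp only [Finset.insert_comm]
  simp only [Finset.insert_comm] at h2 ⊢
  linarith [h2]

instance : LeftCommutative (PickLaw.avg (α := α)) := ⟨fun π ρ F => π.avg_comm ρ F⟩

/-- The expectation of `F` after independent picks, one for each law in `L`, have been added to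
the set `S`. The order of the picks does not matter, whence a multiset of laws. -/
noncomputable def expect (L : Multiset (PickLaw α)) (F : Finset α → ℝ) : Finset α → ℝ :=
  L.foldr PickLaw.avg F

@[simp] theorem expect_zero (F : Finset α → ℝ) : expect 0 F = F := by simp [expect]

@[simp] theorem expect_cons (π : PickLaw α) (L : Multiset (PickLaw α)) (F : Finset α → ℝ) :
    expect (π ::ₘ L) F = π.avg (expect L F) := by simp [expect]

theorem expect_add (L M : Multiset (PickLaw α)) (F : Finset α → ℝ) :
    expect (L + M) F = expect L (expect M F) := by simp [expect, Multiset.foldr_add]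

theorem PickLaw.avg_mono (π : PickLaw α) {F G : Finset α → ℝ} (h : ∀ S, F S ≤ G S)
    (S : Finset α) : π.avg F S ≤ π.avg G S := by
  have h1 := π.sum_prob_le_one
  exact add_le_add (Finset.sum_le_sum fun a _ => mul_le_mul_of_nonneg_left (h _) (π.prob_nonneg a))
    (mul_le_mul_of_nonneg_left (h _) (by linarith))

theorem expect_mono (L : Multiset (PickLaw α)) {F G : Finset α → ℝ} (h : ∀ S, F S ≤ G S)
    (S : Finset α) : expect L F S ≤ expect L G S := by
  induction L using Multiset.induction_on generalizing S with
  | empty => simpa using h S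
  | cons π L ih => simpa using π.avg_mono ih S

/-- Only sets containing the initial set matter for an expectation. -/
theorem expect_mono_of_subset (L : Multiset (PickLaw α)) {F G : Finset α → ℝ} {S : Finset α}
    (h : ∀ T, S ⊆ T → F T ≤ G T) : expect L F S ≤ expect L G S := by
  induction L using Multiset.induction_on generalizing S with
  | empty => simpa using h S subset_rfl
  | cons π L ih =>
    rw [expect_cons, expect_cons]
    have h1 := π.sum_prob_le_one
    exact add_le_add (Finset.sum_le_sum fun a _ => mul_le_mul_of_nonneg_left
      (ih fun T hT => h T ((Finset.subset_insert a S).trans hT)) (π.prob_nonneg a))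
      (mul_le_mul_of_nonneg_left (ih h) (by linarith))

theorem PickLaw.avg_const (π : PickLaw α) (x : ℝ) : π.avg (fun _ => x) = fun _ => x := by
  funext S
  simp only [PickLaw.avg, ← Finset.sum_mul]
  ring

theorem expect_const (L : Multiset (PickLaw α)) (x : ℝ) :
    expect L (fun _ => x) = fun _ => x := by
  induction L using Multiset.induction_on with
  | empty => simp
  | cons π L ih => rw [expect_cons, ih, π.avg_const]

theorem expect_nonneg (L : Multiset (PickLaw α)) {F : Finset α → ℝ} (h : ∀ S, 0 ≤ F S)
    (S : Finset α) : 0 ≤ expect L F S := by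
  simpa [expect_const] using expect_mono L (F := fun _ => 0) h S

theorem PickLaw.avg_add_fun (π : PickLaw α) (F G : Finset α → ℝ) :
    π.avg (fun S => F S + G S) = fun S => π.avg F S + π.avg G S := by
  funext S
  simp only [PickLaw.avg, mul_add, Finset.sum_add_distrib]
  ring

theorem PickLaw.avg_mul_fun (π : PickLaw α) (x : ℝ) (F : Finset α → ℝ) :
    π.avg (fun S => x * F S) = fun S => x * π.avg F S := by
  funext S
  simp only [PickLaw.avg, mul_add, Finset.mul_sum]
  congr 1
  · exact Finset.sum_congr rfl fun a _ => by ring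
  · ring

theorem expect_add_fun (L : Multiset (PickLaw α)) (F G : Finset α → ℝ) (S : Finset α) :
    expect L (fun S => F S + G S) S = expect L F S + expect L G S := by
  induction L using Multiset.induction_on generalizing S with
  | empty => simp
  | cons π L ih => rw [expect_cons, expect_cons, expect_cons, funext ih, π.avg_add_fun]

theorem expect_mul_fun (L : Multiset (PickLaw α)) (x : ℝ) (F : Finset α → ℝ) (S : Finset α) :
    expect L (fun S => x * F S) S = x * expect L F S := by
  induction L using Multiset.induction_on generalizing S with
  | empty => simp
  | cons π L ih => rw [expect_cons, expect_cons, funext ih, π.avg_mul_fun]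

theorem expect_sum_fun {ι : Type*} (L : Multiset (PickLaw α)) (s : Finset ι)
    (F : ι → Finset α → ℝ) (S : Finset α) :
    expect L (fun S => ∑ i ∈ s, F i S) S = ∑ i ∈ s, expect L (F i) S := by
  classical
  induction s using Finset.induction_on generalizing S with
  | empty => simp [expect_const]
  | insert i s hi ih =>
    simp only [Finset.sum_insert hi]
    rw [expect_add_fun, ih]

theorem PickLaw.avg_antitone (π : PickLaw α) {F : Finset α → ℝ} (hF : Antitone F) :
    Antitone (π.avg F) := by
  intro S T hST
  have h1 := π.sum_prob_le_one
  exact add_le_add (Finset.sum_le_sum fun a _ => mul_le_mul_of_nonneg_left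
    (hF (Finset.insert_subset_insert a hST)) (π.prob_nonneg a))
    (mul_le_mul_of_nonneg_left (hF hST) (by linarith))

theorem expect_antitone (L : Multiset (PickLaw α)) {F : Finset α → ℝ} (hF : Antitone F) :
    Antitone (expect L F) := by
  induction L using Multiset.induction_on with
  | empty => simpa using hF
  | cons π L ih => simpa using π.avg_antitone ih

theorem PickLaw.avg_le_self (π : PickLaw α) {F : Finset α → ℝ} (hF : Antitone F)
    (S : Finset α) : π.avg F S ≤ F S := by
  have h : ∑ a, π.prob a * F (insert a S) ≤ ∑ a, π.prob a * F S :=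
    Finset.sum_le_sum fun a _ => mul_le_mul_of_nonneg_left
      (hF (Finset.subset_insert a S)) (π.prob_nonneg a)
  rw [← Finset.sum_mul] at h
  unfold PickLaw.avg
  linarith

theorem expect_le_self (L : Multiset (PickLaw α)) {F : Finset α → ℝ} (hF : Antitone F)
    (S : Finset α) : expect L F S ≤ F S := by
  induction L using Multiset.induction_on generalizing S with
  | empty => simp
  | cons π L ih => rw [expect_cons]; exact (π.avg_mono ih S).trans (π.avg_le_self hF S)

/-- The probability that no pick hits `B` is at most the exponential of minus the expected number
of hits. -/
theorem expect_disjoint_le (L : Multiset (PickLaw α)) (B S : Finset α) :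
    expect L (fun T => if Disjoint T B then 1 else 0) S ≤
      if Disjoint S B then Real.exp (-∑ a ∈ B, rate L a) else 0 := by
  induction L using Multiset.induction_on generalizing S with
  | empty => simp
  | cons π L ih =>
    rw [expect_cons]
    refine (π.avg_mono ih S).trans ?_
    unfold PickLaw.avg
    split_ifs with h
    · set E := Real.exp (-∑ a ∈ B, rate L a)
      have hE : 0 ≤ E := (Real.exp_pos _).le
      have h1 : ∀ a, (π.prob a * if Disjoint (insert a S) B then E else 0) =
          π.prob a * E - (if a ∈ B then π.prob a * E else 0) := by
        intro a
        by_cases ha : a ∈ B <;> simp [Finset.disjoint_insert_left, ha, h]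
      simp only [h1, Finset.sum_sub_distrib, rate_cons, Finset.sum_add_distrib, neg_add,
        Real.exp_add, ← Finset.sum_filter, Finset.filter_mem_eq_inter, Finset.univ_inter,
        ← Finset.sum_mul]
      have h2 := Real.one_sub_le_exp_neg (∑ a ∈ B, π.prob a)
      have h3 := mul_le_mul_of_nonneg_right h2 hE
      simp only [E, if_pos h] at h3 ⊢
      linarith
    · have h1 : ∀ a, ¬ Disjoint (insert a S) B := fun a h' =>
        h (Finset.disjoint_of_subset_left (Finset.subset_insert a S) h')
      simp [h1, h]

/-- **Potential argument.** Let `Φ` be a potential that never increases when elements are added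
and that drops by at least `m a` when a *crossing* element `a ∈ E` is added. Then the expected
number of crossing elements left over at the end, weighted by rate and drop, is at most the initial
potential: an element that crosses at the end has been crossing all the time, so that every pick
of it would have paid. -/
theorem expect_sum_crossing_le (L : Multiset (PickLaw α)) (E : Finset α) (m : α → ℝ)
    (Φ : Finset α → ℝ) (Q : α → Finset α → Prop) [∀ a S, Decidable (Q a S)]
    (hm : ∀ a, 0 ≤ m a) (hΦ0 : ∀ S, 0 ≤ Φ S) (hΦ : Antitone Φ)
    (hQ : ∀ a, Antitone (Q a))
    (hdrop : ∀ a ∈ E, ∀ S, Q a S → Φ (insert a S) + m a ≤ Φ S) (S : Finset α) :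
    ∑ a ∈ E, rate L a * m a * expect L (fun T => if Q a T then 1 else 0) S ≤ Φ S := by
  have hQ' : ∀ a, Antitone (fun T => if Q a T then (1 : ℝ) else 0) := by
    intro a S T hST
    dsimp only
    split_ifs with h1 h2
    · rfl
    · exact absurd (hQ a hST h1) h2
    · norm_num
    · rfl
  induction L using Multiset.induction_on generalizing S with
  | empty => simpa using hΦ0 S
  | cons π L ih =>
    simp only [expect_cons, rate_cons, add_mul, Finset.sum_add_distrib]
    -- The part of the sum paid by the later picks is at most the expected potential after `π`.
    have h1 : ∑ a ∈ E, rate L a * m a *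
        π.avg (expect L (fun T => if Q a T then 1 else 0)) S ≤ π.avg Φ S := by
      refine le_trans (le_of_eq ?_) (π.avg_mono ih S)
      have := expect_sum_fun {π} E
        (fun a T => rate L a * m a * expect L (fun T => if Q a T then 1 else 0) T) S
      simp only [← Multiset.cons_zero, expect_cons, expect_zero] at this
      rw [this]
      exact Finset.sum_congr rfl fun a _ => by rw [π.avg_mul_fun]
    have h2 : ∑ a ∈ E, π.prob a * m a *
        π.avg (expect L (fun T => if Q a T then 1 else 0)) S ≤
        ∑ a ∈ E, π.prob a * (Φ S - Φ (insert a S)) := by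
      refine Finset.sum_le_sum fun a ha => ?_
      rw [mul_assoc]
      refine mul_le_mul_of_nonneg_left ?_ (π.prob_nonneg a)
      have h3 : π.avg (expect L (fun T => if Q a T then 1 else 0)) S ≤ if Q a S then 1 else 0 := by
        have := expect_le_self (π ::ₘ L) (hQ' a) S
        rwa [expect_cons] at this
      refine (mul_le_mul_of_nonneg_left h3 (hm a)).trans ?_
      split_ifs with h
      · linarith [hdrop a ha S h]
      · linarith [hΦ (Finset.subset_insert a S)]
    have h4 : ∑ a ∈ E, π.prob a * (Φ S - Φ (insert a S)) ≤
        ∑ a, π.prob a * (Φ S - Φ (insert a S)) :=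
      Finset.sum_le_sum_of_subset_of_nonneg (Finset.subset_univ _) fun a _ _ =>
        mul_nonneg (π.prob_nonneg a) (by linarith [hΦ (Finset.subset_insert a S)])
    have h5 : ∑ a, π.prob a * (Φ S - Φ (insert a S)) + π.avg Φ S = Φ S := by
      simp only [PickLaw.avg, mul_sub, Finset.sum_sub_distrib, ← Finset.sum_mul]
      ring
    linarith

end PickLaw

/-! ### Stochastic domination of independent picks by the two models -/

/-- Double counting of the pairs consisting of a `j`-subset of `N` and a further element. -/
theorem sum_powersetCard_insert {α : Type*} [DecidableEq α] (N : Finset α) (j : ℕ)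
    (g : Finset α → ℝ) :
    ∑ s ∈ N.powersetCard j, ∑ x ∈ N \ s, g (insert x s) =
      (j + 1) * ∑ t ∈ N.powersetCard (j + 1), g t := by
  have h : ∀ t ∈ N.powersetCard (j + 1), (j + 1 : ℝ) * g t = ∑ x ∈ t, g t := by
    intro t ht
    rw [Finset.sum_const, (Finset.mem_powersetCard.1 ht).2]
    simp
  rw [Finset.mul_sum, Finset.sum_congr rfl h, Finset.sum_sigma', Finset.sum_sigma']
  refine Finset.sum_bij' (fun p _ => ⟨insert p.2 p.1, p.2⟩) (fun p _ => ⟨p.1.erase p.2, p.2⟩)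
    ?_ ?_ ?_ ?_ ?_
  · rintro ⟨s, x⟩ hp
    simp only [Finset.mem_sigma, Finset.mem_powersetCard, Finset.mem_sdiff] at hp ⊢
    obtain ⟨⟨hs, hc⟩, hx, hxs⟩ := hp
    exact ⟨⟨Finset.insert_subset hx hs, by rw [Finset.card_insert_of_notMem hxs, hc]⟩,
      Finset.mem_insert_self _ _⟩
  · rintro ⟨t, x⟩ hp
    simp only [Finset.mem_sigma, Finset.mem_powersetCard, Finset.mem_sdiff] at hp ⊢
    obtain ⟨⟨ht, hc⟩, hx⟩ := hp
    exact ⟨⟨(Finset.erase_subset _ _).trans ht, by rw [Finset.card_erase_of_mem hx, hc]; rfl⟩,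
      ht hx, Finset.notMem_erase _ _⟩
  · rintro ⟨s, x⟩ hp
    simp only [Finset.mem_sigma, Finset.mem_sdiff] at hp
    simp [Finset.erase_insert hp.2.2]
  · rintro ⟨t, x⟩ hp
    simp only [Finset.mem_sigma] at hp
    simp [Finset.insert_erase hp.2]
  · rintro ⟨s, x⟩ _
    rfl

section Domination

variable {α : Type*} [Fintype α] [DecidableEq α]

/-- Comparison of a product law with independent picks: it suffices to compare each coordinate
with its own picks. -/
theorem lintegral_pi_le_expect {ι X : Type*} [Fintype ι] [MeasurableSpace X] [Finite X]
    [MeasurableSingletonClass X] (μ : ι → Measure X) [∀ i, IsProbabilityMeasure (μ i)]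
    (A : ι → X → Finset α) (L : ι → Multiset (PickLaw α))
    (h : ∀ i (g : Finset α → ℝ), Antitone g → (∀ S, 0 ≤ g S) → ∀ S,
      ∫⁻ x, ENNReal.ofReal (g (A i x ∪ S)) ∂μ i ≤ ENNReal.ofReal (expect (L i) g S))
    {F : Finset α → ℝ} (hF : Antitone F) (hF0 : ∀ S, 0 ≤ F S) :
    ∫⁻ ω, ENNReal.ofReal (F (Finset.univ.biUnion fun i => A i (ω i))) ∂Measure.pi μ ≤
      ENNReal.ofReal (expect (∑ i, L i) F ∅) := by
  classical
  set f : (ι → X) → ℝ≥0∞ :=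
    fun ω => ENNReal.ofReal (F (Finset.univ.biUnion fun i => A i (ω i))) with hf
  have hfm : Measurable f := Measurable.of_discrete
  -- The coordinates in `s` are replaced by picks, one coordinate at a time.
  have key : ∀ (s : Finset ι) (x : ι → X), lmarginal μ s f x ≤
      ENNReal.ofReal (expect (∑ i ∈ s, L i) F (sᶜ.biUnion fun i => A i (x i))) := by
    intro s
    induction s using Finset.induction_on with
    | empty => intro x; simp [hf]
    | insert i s hi ih =>
      intro x
      rw [lmarginal_insert f hfm hi, Finset.sum_insert hi, expect_add]
      refine le_trans (lintegral_mono fun y => ih _) ?_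
      refine le_trans (le_of_eq ?_) (h i _ (expect_antitone (∑ j ∈ s, L j) hF)
        (expect_nonneg _ hF0) _)
      refine lintegral_congr fun y => ?_
      congr 2
      have hs : sᶜ = insert i (insert i s)ᶜ := by
        ext j
        by_cases hj : j = i
        · subst hj; simp [hi]
        · simp [hj]
      rw [hs, Finset.biUnion_insert, Function.update_self]
      congr 1
      refine Finset.biUnion_congr rfl fun j hj => ?_
      rw [Function.update_of_ne]
      rintro rfl
      simp at hj
  obtain hX | ⟨⟨x⟩⟩ := isEmpty_or_nonempty (ι → X)
  · simp [Measure.eq_zero_of_isEmpty]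
  · rw [lintegral_eq_lmarginal_univ x]
    simpa using key Finset.univ x

/-- A fixed element picked with probability `q`. -/
noncomputable def singlePick (a : α) (q : ℝ) (h0 : 0 ≤ q) (h1 : q ≤ 1) : PickLaw α where
  prob b := if b = a then q else 0
  prob_nonneg b := by split_ifs <;> simp [h0]
  sum_prob_le_one := by simpa using h1

/-- A uniformly random element of `N` is picked (nothing if `N` is empty). -/
noncomputable def uniformPick (N : Finset α) : PickLaw α where
  prob b := if b ∈ N then (N.card : ℝ)⁻¹ else 0
  prob_nonneg b := by split_ifs <;> positivity
  sum_prob_le_one := by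
    rw [← Finset.sum_filter, Finset.filter_mem_eq_inter, Finset.univ_inter, Finset.sum_const,
      nsmul_eq_mul]
    exact mul_inv_le_one

theorem expect_nsmul_singlePick (a : α) (q : ℝ) (h0 : 0 ≤ q) (h1 : q ≤ 1) (R : ℕ)
    (g : Finset α → ℝ) (S : Finset α) :
    expect (R • {singlePick a q h0 h1}) g S =
      (1 - (1 - q) ^ R) * g (insert a S) + (1 - q) ^ R * g S := by
  induction R generalizing S with
  | zero => simp
  | succ R ih =>
    rw [succ_nsmul', expect_add]
    simp only [← Multiset.cons_zero, expect_cons, expect_zero] at ih ⊢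
    have h : ∀ H : Finset α → ℝ, (singlePick a q h0 h1).avg H S =
        q * H (insert a S) + (1 - q) * H S := fun H => by simp [PickLaw.avg, singlePick]
    rw [h, ih, ih, Finset.insert_idem]
    ring

/-- A Bernoulli sample dominates independent picks of the same element whose total rate is at most
the sampling probability. -/
theorem lintegral_bernoulli_le_expect (a : α) (q : ℝ) (h0 : 0 ≤ q) (h1 : q ≤ 1) (R : ℕ)
    (p : unitInterval) (hp : 1 - (1 - q) ^ R ≤ p) {g : Finset α → ℝ} (hg : Antitone g)
    (hg0 : ∀ S, 0 ≤ g S) (S : Finset α) :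
    ∫⁻ b, ENNReal.ofReal (g ((if b = true then {a} else ∅) ∪ S))
        ∂ProbabilityTheory.bernoulliMeasure true false p ≤
      ENNReal.ofReal (expect (R • {singlePick a q h0 h1}) g S) := by
  rw [← ofReal_integral_eq_lintegral_ofReal .of_finite (Filter.Eventually.of_forall fun _ => hg0 _)]
  refine ENNReal.ofReal_le_ofReal ?_
  rw [ProbabilityTheory.integral_bernoulliMeasure, expect_nsmul_singlePick]
  have h := mul_le_mul_of_nonneg_right hp (sub_nonneg.2 (hg (Finset.subset_insert a S)))
  simp [Finset.singleton_union]
  linarith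

/-- The average of `g` over the `j`-subsets of `N`. -/
noncomputable def subsetAvg (N : Finset α) (j : ℕ) (g : Finset α → ℝ) : ℝ :=
  (∑ s ∈ N.powersetCard j, g s) / (N.card.choose j : ℝ)

/-- A random `j`-subset to which a uniformly random element is added is dominated by a random
`(j + 1)`-subset. -/
theorem subsetAvg_succ_le {N : Finset α} {j : ℕ} (hj : j < N.card) {g : Finset α → ℝ}
    (hg : Antitone g) (S : Finset α) :
    subsetAvg N (j + 1) (fun s => g (s ∪ S)) ≤
      subsetAvg N j (fun s => (uniformPick N).avg g (s ∪ S)) := by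
  set d := N.card with hd
  set A := ∑ s ∈ N.powersetCard j, g (s ∪ S) with hA
  set B := ∑ s ∈ N.powersetCard (j + 1), g (s ∪ S) with hB
  have hdpos : (0 : ℝ) < d := by exact_mod_cast (by omega : 0 < d)
  have hjd : (0 : ℝ) < (d : ℝ) - j := sub_pos.2 (by exact_mod_cast hj)
  have hC : (0 : ℝ) < d.choose j := by exact_mod_cast Nat.choose_pos hj.le
  have hC' : ((d.choose (j + 1) : ℕ) : ℝ) * (j + 1) = d.choose j * ((d : ℝ) - j) := by
    have := Nat.choose_succ_right_eq d j
    rw [← Nat.cast_sub hj.le]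
    exact_mod_cast this
  have hdc := sum_powersetCard_insert N j (fun s => g (s ∪ S))
  have hle : (j + 1) * B ≤ ((d : ℝ) - j) * A := by
    rw [← hdc, Finset.mul_sum]
    refine Finset.sum_le_sum fun s hs => ?_
    obtain ⟨hs, hc⟩ := Finset.mem_powersetCard.1 hs
    have h1 : ∑ x ∈ N \ s, g (insert x s ∪ S) ≤ ∑ x ∈ N \ s, g (s ∪ S) :=
      Finset.sum_le_sum fun x _ =>
        hg (Finset.union_subset_union_left (Finset.subset_insert x s))
    rw [Finset.sum_const, Finset.card_sdiff_of_subset hs, hc, nsmul_eq_mul,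
      Nat.cast_sub hj.le] at h1
    exact h1
  have havg : ∀ T, (uniformPick N).avg g T = (d : ℝ)⁻¹ * ∑ x ∈ N, g (insert x T) := by
    intro T
    simp only [PickLaw.avg, uniformPick, ite_mul, zero_mul, ← Finset.sum_filter,
      Finset.filter_mem_eq_inter, Finset.univ_inter, Finset.sum_const, nsmul_eq_mul, ← hd,
      ← Finset.mul_sum]
    rw [mul_inv_cancel₀ hdpos.ne']
    ring
  have hsum : ∑ s ∈ N.powersetCard j, (uniformPick N).avg g (s ∪ S) =
      (d : ℝ)⁻¹ * (j * A + (j + 1) * B) := by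
    simp only [havg, ← Finset.mul_sum]
    congr 1
    rw [← hdc, hA, Finset.mul_sum, ← Finset.sum_add_distrib]
    refine Finset.sum_congr rfl fun s hs => ?_
    obtain ⟨hs, hc⟩ := Finset.mem_powersetCard.1 hs
    rw [← Finset.sum_sdiff hs, add_comm]
    simp only [Finset.insert_union]
    congr 1
    rw [← hc, ← nsmul_eq_mul, ← Finset.sum_const]
    refine Finset.sum_congr rfl fun x hx => ?_
    rw [Finset.insert_eq_of_mem (Finset.mem_union_left _ hx)]
  unfold subsetAvg
  rw [hsum, ← hB, ← hd]
  have hC1 : (0 : ℝ) < d.choose (j + 1) := by exact_mod_cast Nat.choose_pos hj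
  have hCe : ((d.choose (j + 1) : ℕ) : ℝ) = d.choose j * ((d : ℝ) - j) / (j + 1) := by
    rw [← hC']; field_simp
  rw [hCe, div_le_div_iff₀ (by positivity) hC]
  have h3 : (j : ℝ) * ((j + 1) * B) ≤ j * (((d : ℝ) - j) * A) :=
    mul_le_mul_of_nonneg_left hle (by positivity)
  have h4 : (d : ℝ)⁻¹ * (j * A + (j + 1) * B) * (d.choose j * ((d : ℝ) - j) / (j + 1)) -
      B * d.choose j = d.choose j / (d * (j + 1)) *
        (j * (((d : ℝ) - j) * A) - j * ((j + 1) * B)) := by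
    field_simp
    ring
  have h5 : 0 ≤ (d.choose j : ℝ) / (d * (j + 1)) *
        (j * (((d : ℝ) - j) * A) - j * ((j + 1) * B)) :=
    mul_nonneg (by positivity) (by linarith)
  linarith

/-- A uniformly random set of `min j (card N)` elements dominates `j` uniformly random elements
chosen independently, with replacement. -/
theorem subsetAvg_le_expect (N : Finset α) (j : ℕ) {g : Finset α → ℝ} (hg : Antitone g)
    (S : Finset α) :
    subsetAvg N (min j N.card) (fun s => g (s ∪ S)) ≤ expect (j • {uniformPick N}) g S := by
  induction j generalizing g with
  | zero => simp [subsetAvg]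
  | succ j ih =>
    have h := ih ((uniformPick N).avg_antitone hg)
    rw [succ_nsmul, expect_add, ← Multiset.cons_zero, expect_cons, expect_zero, Multiset.cons_zero]
    refine le_trans ?_ h
    obtain hj | hj := lt_or_ge j N.card
    · rw [min_eq_left hj.le, min_eq_left (Nat.succ_le_of_lt hj)]
      exact subsetAvg_succ_le hj hg S
    · rw [min_eq_right hj, min_eq_right (hj.trans j.le_succ)]
      have : (uniformPick N).avg g (N ∪ S) = g (N ∪ S) := by
        have h1 : ∀ a, (uniformPick N).prob a * g (insert a (N ∪ S)) =
            (uniformPick N).prob a * g (N ∪ S) := by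
          intro a
          by_cases ha : a ∈ N
          · rw [Finset.insert_eq_of_mem (Finset.mem_union_left _ ha)]
          · simp [uniformPick, ha]
        simp only [PickLaw.avg, h1, ← Finset.sum_mul]
        ring
      simp [subsetAvg, this]

/-- The form of `subsetAvg_le_expect` for the uniform law on a family of subsets. -/
theorem lintegral_uniform_le_expect [MeasurableSpace (Finset α)]
    [MeasurableSingletonClass (Finset α)] (N : Finset α) (j : ℕ)
    {C : Finset (Finset α)} (hC : C = N.powersetCard (min j N.card)) (hne : C.Nonempty)
    {g : Finset α → ℝ} (hg : Antitone g) (hg0 : ∀ S, 0 ≤ g S) (S : Finset α) :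
    ∫⁻ s, ENNReal.ofReal (g (s ∪ S)) ∂(PMF.uniformOfFinset C hne).toMeasure ≤
      ENNReal.ofReal (expect (j • {uniformPick N}) g S) := by
  subst hC
  rw [← ofReal_integral_eq_lintegral_ofReal .of_finite (Filter.Eventually.of_forall fun _ => hg0 _)]
  refine ENNReal.ofReal_le_ofReal ((le_of_eq ?_).trans (subsetAvg_le_expect N j hg S))
  rw [PMF.integral_eq_sum]
  simp only [PMF.uniformOfFinset_apply, Finset.card_powersetCard, apply_ite ENNReal.toReal,
    ENNReal.toReal_inv, ENNReal.toReal_natCast, ENNReal.toReal_zero, smul_eq_mul, ite_mul,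
    zero_mul, ← Finset.sum_filter, Finset.filter_mem_eq_inter, Finset.univ_inter,
    ← Finset.mul_sum]
  rw [subsetAvg, inv_mul_eq_div]

end Domination

/-! ### Boundaries, closed sets and leaders -/

section Core

variable {V : Type*}

/-- The graph with edge set `S`. -/
abbrev edgeGraph (S : Finset (Sym2 V)) : SimpleGraph V := SimpleGraph.fromEdgeSet (S : Set (Sym2 V))

theorem edgeGraph_mono {S T : Finset (Sym2 V)} (h : S ⊆ T) : edgeGraph S ≤ edgeGraph T :=
  SimpleGraph.fromEdgeSet_mono (by exact_mod_cast h)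

/-- `A` is a union of connected components of the graph with edge set `S`. -/
def IsClosedIn (S : Finset (Sym2 V)) (A : Finset V) : Prop :=
  ∀ u v, (edgeGraph S).Adj u v → u ∈ A → v ∈ A

theorem mem_of_reachable {H : SimpleGraph V} {A : Set V} (hA : ∀ u v, H.Adj u v → u ∈ A → v ∈ A)
    {u v : V} (h : H.Reachable u v) (hu : u ∈ A) : v ∈ A := by
  obtain ⟨p⟩ := h
  induction p with
  | nil => exact hu
  | cons hadj _ ih => exact ih (hA _ _ hadj hu)

theorem IsClosedIn.mono {S T : Finset (Sym2 V)} (h : S ⊆ T) {A : Finset V}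
    (hA : IsClosedIn T A) : IsClosedIn S A :=
  fun u v huv hu => hA u v (edgeGraph_mono h huv) hu

theorem IsClosedIn.mem_of_reachable {S : Finset (Sym2 V)} {A : Finset V} (hA : IsClosedIn S A)
    {u v : V} (h : (edgeGraph S).Reachable u v) (hu : u ∈ A) : v ∈ A :=
  RandomKOut.mem_of_reachable (A := (A : Set V)) hA h hu

/-- The endpoints of `e` lie in different connected components of the graph with edge set `S`. -/
def Crosses (e : Sym2 V) (S : Finset (Sym2 V)) : Prop :=
  ∃ u v, e = s(u, v) ∧ ¬ (edgeGraph S).Reachable u v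

theorem crosses_antitone (e : Sym2 V) : Antitone (Crosses e) := by
  rintro S T hST ⟨u, v, rfl, h⟩
  exact ⟨u, v, rfl, fun h' => h (h'.mono (edgeGraph_mono hST))⟩

variable [Fintype V]

open scoped Classical in
/-- The vertex set of the connected component of `v` in the graph with edge set `S`. -/
noncomputable def comp (S : Finset (Sym2 V)) (v : V) : Finset V :=
  {w | (edgeGraph S).Reachable v w}

theorem mem_comp {S : Finset (Sym2 V)} {v w : V} :
    w ∈ comp S v ↔ (edgeGraph S).Reachable v w := by simp [comp]

theorem self_mem_comp (S : Finset (Sym2 V)) (v : V) : v ∈ comp S v := mem_comp.2 .rfl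

theorem isClosedIn_comp (S : Finset (Sym2 V)) (v : V) : IsClosedIn S (comp S v) :=
  fun _ _ huw hu => mem_comp.2 ((mem_comp.1 hu).trans huw.reachable)

open scoped Classical in
/-- The vertices of highest rank in their connected component. If `f` is injective, there is
exactly one in each component. -/
noncomputable def leaders (f : V → ℕ) (S : Finset (Sym2 V)) : Finset V :=
  {v | ∀ w, (edgeGraph S).Reachable v w → f w ≤ f v}

theorem mem_leaders {f : V → ℕ} {S : Finset (Sym2 V)} {v : V} :
    v ∈ leaders f S ↔ ∀ w, (edgeGraph S).Reachable v w → f w ≤ f v := by simp [leaders]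

theorem leaders_antitone (f : V → ℕ) : Antitone (leaders (V := V) f) := fun _ _ hST _ hv =>
  mem_leaders.2 fun w hw => mem_leaders.1 hv w (hw.mono (edgeGraph_mono hST))

theorem exists_leader (f : V → ℕ) (S : Finset (Sym2 V)) (v : V) :
    ∃ w ∈ leaders f S, (edgeGraph S).Reachable v w ∧ f v ≤ f w := by
  obtain ⟨w, hw, hmax⟩ := (comp S v).exists_max_image f ⟨v, self_mem_comp S v⟩
  refine ⟨w, mem_leaders.2 fun x hx => hmax x (mem_comp.2 ((mem_comp.1 hw).trans hx)),
    mem_comp.1 hw, hmax v (self_mem_comp S v)⟩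

theorem eq_of_mem_leaders {f : V → ℕ} (hf : Function.Injective f) {S : Finset (Sym2 V)} {v w : V}
    (hv : v ∈ leaders f S) (hw : w ∈ leaders f S) (h : (edgeGraph S).Reachable v w) : v = w :=
  hf (le_antisymm (mem_leaders.1 hw v h.symm) (mem_leaders.1 hv w h))

theorem sum_card_comp_leaders_le {f : V → ℕ} (hf : Function.Injective f) (S : Finset (Sym2 V)) :
    ∑ v ∈ leaders f S, (comp S v).card ≤ Fintype.card V := by
  classical
  rw [← Finset.card_biUnion]
  · exact Finset.card_le_univ _
  · intro v hv w hw hvw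
    refine Finset.disjoint_left.2 fun x hx hx' => hvw (eq_of_mem_leaders hf hv hw ?_)
    exact (mem_comp.1 hx).trans (mem_comp.1 hx').symm

open scoped Classical in
/-- A closed set is determined by the leaders it contains. -/
theorem card_isClosedIn_le {f : V → ℕ} (S : Finset (Sym2 V)) :
    ((Finset.univ : Finset (Finset V)).filter (IsClosedIn S)).card ≤ 2 ^ (leaders f S).card := by
  rw [← Finset.card_powerset]
  refine Finset.card_le_card_of_injOn (fun A => A ∩ leaders f S)
    (fun A _ => by simp) ?_
  have key : ∀ A B : Finset V, IsClosedIn S A → IsClosedIn S B →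
      A ∩ leaders f S = B ∩ leaders f S → A ⊆ B := by
    intro A B hA hB hAB v hv
    obtain ⟨w, hw, hvw, -⟩ := exists_leader f S v
    have : w ∈ B ∩ leaders f S := hAB ▸ Finset.mem_inter.2 ⟨hA.mem_of_reachable hvw hv, hw⟩
    exact hB.mem_of_reachable hvw.symm (Finset.mem_inter.1 this).1
  intro A hA B hB hAB
  simp only [Finset.coe_filter, Finset.mem_univ, true_and, Set.mem_ofPred_eq] at hA hB
  exact (key A B hA hB hAB).antisymm (key B A hB hA hAB.symm)

variable (G : SimpleGraph V) [DecidableRel G.Adj]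

/-- The vertices can be ranked by degree, with ties broken arbitrarily. -/
theorem exists_rank : ∃ f : V → ℕ, Function.Injective f ∧
    ∀ u v, f u ≤ f v → G.degree u ≤ G.degree v := by
  classical
  let e := Fintype.equivFin V
  have key : ∀ u v, G.degree u < G.degree v →
      G.degree u * Fintype.card V + e u < G.degree v * Fintype.card V + e v := by
    intro u v h
    have h1 := (e u).isLt
    have h2 : (G.degree u + 1) * Fintype.card V ≤ G.degree v * Fintype.card V :=
      Nat.mul_le_mul_right _ h
    rw [add_mul, one_mul] at h2
    omega
  refine ⟨fun v => G.degree v * Fintype.card V + e v, fun u v huv => ?_, fun u v huv => ?_⟩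
  · dsimp only at huv
    rcases lt_trichotomy (G.degree u) (G.degree v) with h | h | h
    · exact absurd huv (key u v h).ne
    · rw [h] at huv
      exact e.injective (Fin.ext (by omega))
    · exact absurd huv (key v u h).ne'
  · by_contra! h
    exact absurd huv (not_le.2 (key v u h))

/-- The potential: the sum over the connected components of the largest degree (in `G`) of a
vertex of the component, provided that the rank `f` is injective and increasing in the degree. -/
noncomputable def potential (f : V → ℕ) (S : Finset (Sym2 V)) : ℝ :=
  ∑ v ∈ leaders f S, (G.degree v : ℝ)

theorem potential_nonneg (f : V → ℕ) (S : Finset (Sym2 V)) : 0 ≤ potential G f S :=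
  Finset.sum_nonneg fun _ _ => Nat.cast_nonneg _

theorem potential_antitone (f : V → ℕ) : Antitone (potential G f) := fun _ _ hST =>
  Finset.sum_le_sum_of_subset_of_nonneg (leaders_antitone f hST) fun _ _ _ => Nat.cast_nonneg _

/-- The smaller of the degrees of the two endpoints. -/
def minDegreeOf : Sym2 V → ℝ :=
  Sym2.lift ⟨fun u v => min (G.degree u : ℝ) (G.degree v), fun _ _ => min_comm _ _⟩

theorem minDegreeOf_nonneg (e : Sym2 V) : 0 ≤ minDegreeOf G e := by
  induction e with
  | _ u v => simp [minDegreeOf]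

variable [DecidableEq V]

/-- An inserted edge merges two components, and the leader of one of them loses its status. -/
theorem potential_insert_add_le {f : V → ℕ} (hf : Function.Injective f)
    (hfd : ∀ u v, f u ≤ f v → G.degree u ≤ G.degree v) {e : Sym2 V} {S : Finset (Sym2 V)}
    (he : Crosses e S) : potential G f (insert e S) + minDegreeOf G e ≤ potential G f S := by
  obtain ⟨u, v, rfl, huv⟩ := he
  have hne : u ≠ v := fun h => huv (h ▸ .rfl)
  have hadj : (edgeGraph (insert s(u, v) S)).Adj u v := by simp [hne]
  have hsub := edgeGraph_mono (Finset.subset_insert s(u, v) S)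
  obtain ⟨a, ha, hua, hfa⟩ := exists_leader f S u
  obtain ⟨b, hb, hvb, hfb⟩ := exists_leader f S v
  have hab : a ≠ b := fun h => huv (hua.trans (h ▸ hvb.symm))
  have hreach : (edgeGraph (insert s(u, v) S)).Reachable a b :=
    ((hua.mono hsub).symm.trans hadj.reachable).trans (hvb.mono hsub)
  have key : ∀ x ∈ leaders f S, x ∉ leaders f (insert s(u, v) S) →
      minDegreeOf G s(u, v) ≤ G.degree x →
      potential G f (insert s(u, v) S) + minDegreeOf G s(u, v) ≤ potential G f S := by
    intro x hx hx' hd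
    have h1 : insert x (leaders f (insert s(u, v) S)) ⊆ leaders f S :=
      Finset.insert_subset hx (leaders_antitone f (Finset.subset_insert _ _))
    have h2 := Finset.sum_le_sum_of_subset_of_nonneg h1
      (f := fun v => (G.degree v : ℝ)) fun _ _ _ => Nat.cast_nonneg _
    rw [Finset.sum_insert hx'] at h2
    unfold potential
    linarith
  rcases lt_or_gt_of_ne (hf.ne hab) with h | h
  · refine key a ha (fun h' => absurd (mem_leaders.1 h' b hreach) (not_le.2 h)) ?_
    exact (min_le_left _ _).trans (by exact_mod_cast hfd _ _ hfa)
  · refine key b hb (fun h' => absurd (mem_leaders.1 h' a hreach.symm) (not_le.2 h)) ?_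
    exact (min_le_right _ _).trans (by exact_mod_cast hfd _ _ hfb)

open scoped Classical in
/-- The edges of `G` between `A` and its complement. -/
noncomputable def edgeBoundary (A : Finset V) : Finset (Sym2 V) :=
  G.edgeFinset.filter fun e => ∃ u v, e = s(u, v) ∧ u ∈ A ∧ v ∉ A

theorem mem_edgeBoundary {A : Finset V} {e : Sym2 V} :
    e ∈ edgeBoundary G A ↔ e ∈ G.edgeSet ∧ ∃ u v, e = s(u, v) ∧ u ∈ A ∧ v ∉ A := by
  simp [edgeBoundary]

theorem le_card_edgeBoundary {r : ℕ} (hG : G.IsEdgeConnected r) {A : Finset V} (hA : A.Nonempty)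
    (hA' : A ≠ Finset.univ) : r ≤ (edgeBoundary G A).card := by
  by_contra! h
  obtain ⟨u, hu⟩ := hA
  obtain ⟨v, hv⟩ : ∃ v, v ∉ A := by simpa [Finset.eq_univ_iff_forall] using hA'
  refine hv (mem_of_reachable (A := (A : Set V)) ?_
    (hG u v (s := (edgeBoundary G A : Set (Sym2 V))) ?_) hu)
  · intro x y hxy hx
    by_contra hy
    rw [SimpleGraph.deleteEdges_adj] at hxy
    exact hxy.2 (Finset.mem_coe.2 ((mem_edgeBoundary G).2 ⟨hxy.1, x, y, rfl, hx, hy⟩))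
  · rw [Set.encard_coe_eq_coe_finsetCard]
    exact_mod_cast h

theorem IsClosedIn.disjoint_edgeBoundary {S : Finset (Sym2 V)} {A : Finset V}
    (hA : IsClosedIn S A) : Disjoint S (edgeBoundary G A) := by
  refine Finset.disjoint_left.2 fun e heS he => ?_
  obtain ⟨-, u, v, rfl, hu, hv⟩ := (mem_edgeBoundary G).1 he
  refine hv (hA u v ?_ hu)
  simp only [SimpleGraph.fromEdgeSet_adj, Finset.mem_coe]
  exact ⟨heS, fun h => hv (h ▸ hu)⟩

theorem crosses_of_mem_edgeBoundary {S : Finset (Sym2 V)} {A : Finset V}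
    (hA : IsClosedIn S A) {e : Sym2 V} (he : e ∈ edgeBoundary G A) : Crosses e S := by
  obtain ⟨-, u, v, rfl, hu, hv⟩ := (mem_edgeBoundary G).1 he
  exact ⟨u, v, rfl, fun h => hv (hA.mem_of_reachable h hu)⟩

/-- If the vertices of `U ⊆ A` have degree at least `2 * card A`, then at least half of the edges
at each of them leave `A`. -/
theorem le_sum_edgeBoundary {κ : ℝ} (hκ : 0 ≤ κ) {ρ : Sym2 V → ℝ} (hρ0 : ∀ e, 0 ≤ ρ e)
    (hρ : ∀ e ∈ G.edgeSet, ∀ v ∈ e, κ ≤ ρ e * G.degree v) {A U : Finset V} (hUA : U ⊆ A)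
    (hU : ∀ v ∈ U, 2 * A.card ≤ G.degree v) :
    κ / 2 * U.card ≤ ∑ e ∈ edgeBoundary G A, ρ e := by
  have h1 : ∑ v ∈ U, ∑ w ∈ G.neighborFinset v \ A, ρ s(v, w) ≤ ∑ e ∈ edgeBoundary G A, ρ e := by
    rw [Finset.sum_sigma']
    have hinj : Set.InjOn (fun p : (_ : V) × V => s(p.1, p.2))
        (U.sigma fun v => G.neighborFinset v \ A : Finset _) := by
      rintro ⟨v, w⟩ h ⟨v', w'⟩ h' heq
      simp only [Finset.coe_sigma, Set.mem_sigma_iff, Finset.mem_coe, Finset.mem_sdiff] at h h'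
      rcases Sym2.eq_iff.1 heq with ⟨h1, h2⟩ | ⟨h1, h2⟩
      · dsimp only at h1 h2
        subst h1 h2; rfl
      · dsimp only at h1 h2
        exact absurd (hUA (h2 ▸ h'.1)) h.2.2
    rw [← Finset.sum_image (f := ρ) hinj]
    refine Finset.sum_le_sum_of_subset_of_nonneg ?_ fun e _ _ => hρ0 e
    intro e he
    obtain ⟨⟨v, w⟩, hp, rfl⟩ := Finset.mem_image.1 he
    simp only [Finset.mem_sigma, Finset.mem_sdiff, SimpleGraph.mem_neighborFinset] at hp
    exact (mem_edgeBoundary G).2 ⟨hp.2.1, v, w, rfl, hUA hp.1, hp.2.2⟩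
  refine le_trans ?_ h1
  rw [mul_comm, ← nsmul_eq_mul, ← Finset.sum_const]
  refine Finset.sum_le_sum fun v hv => ?_
  have hA : 0 < A.card := Finset.card_pos.2 ⟨v, hUA hv⟩
  have hd : (0 : ℝ) < G.degree v := by exact_mod_cast (by have := hU v hv; omega)
  have hcard : (G.degree v : ℝ) ≤ 2 * (G.neighborFinset v \ A).card := by
    have h2 := Finset.le_card_sdiff A (G.neighborFinset v)
    rw [SimpleGraph.card_neighborFinset_eq_degree] at h2
    have := hU v hv
    exact_mod_cast (by omega : G.degree v ≤ 2 * (G.neighborFinset v \ A).card)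
  have h3 : ∑ w ∈ G.neighborFinset v \ A, κ / G.degree v ≤
      ∑ w ∈ G.neighborFinset v \ A, ρ s(v, w) := by
    refine Finset.sum_le_sum fun w hw => ?_
    rw [div_le_iff₀ hd]
    simp only [Finset.mem_sdiff, SimpleGraph.mem_neighborFinset] at hw
    exact hρ _ hw.1 v (Sym2.mem_mk_left v w)
  refine le_trans ?_ h3
  rw [Finset.sum_const, nsmul_eq_mul, mul_div_assoc', le_div_iff₀ hd]
  nlinarith

/-! ### The three phases -/

open scoped Classical in
/-- Picks of sufficient rate leave no small closed sets, because the edges leaving a set smaller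
than half the minimum degree make up at least half of the edges at its vertices. -/
theorem expect_exists_small_le (L : Multiset (PickLaw (Sym2 V))) {κ r : ℝ} (hκ : 0 ≤ κ)
    (hL : ∀ e ∈ G.edgeSet, ∀ v ∈ e, κ ≤ rate L e * G.degree v) (hr : ∀ v, r ≤ G.degree v) :
    expect L (fun T => if ∃ A : Finset V, A.Nonempty ∧ 2 * (A.card : ℝ) < r ∧ IsClosedIn T A
      then 1 else 0) ∅ ≤ (1 + Real.exp (-(κ / 2))) ^ Fintype.card V - 1 := by
  set 𝒜 : Finset (Finset V) :=
    Finset.univ.filter fun A => A.Nonempty ∧ 2 * (A.card : ℝ) < r with h𝒜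
  have h1 : ∀ T : Finset (Sym2 V),
      (if ∃ A : Finset V, A.Nonempty ∧ 2 * (A.card : ℝ) < r ∧ IsClosedIn T A
        then (1 : ℝ) else 0) ≤
      ∑ A ∈ 𝒜, if Disjoint T (edgeBoundary G A) then (1 : ℝ) else 0 := by
    intro T
    have h0 : ∀ A ∈ 𝒜, (0 : ℝ) ≤ if Disjoint T (edgeBoundary G A) then (1 : ℝ) else 0 :=
      fun A _ => by split_ifs <;> norm_num
    split_ifs with h
    · obtain ⟨A, hA, hAr, hAT⟩ := h
      have := Finset.single_le_sum h0 (a := A) (by simp [h𝒜, hA, hAr])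
      rwa [if_pos (hAT.disjoint_edgeBoundary G)] at this
    · exact Finset.sum_nonneg h0
  have h2 : ∀ A ∈ 𝒜, expect L (fun T => if Disjoint T (edgeBoundary G A) then (1 : ℝ) else 0) ∅ ≤
      Real.exp (-(κ / 2)) ^ A.card := by
    intro A hA
    simp only [h𝒜, Finset.mem_filter, Finset.mem_univ, true_and] at hA
    have h3 := expect_disjoint_le L (edgeBoundary G A) ∅
    rw [if_pos (Finset.disjoint_empty_left _)] at h3
    refine h3.trans ?_
    rw [← Real.exp_nat_mul, Real.exp_le_exp]
    have h4 := le_sum_edgeBoundary G hκ (rate_nonneg L) hL (subset_refl A) fun v _ => by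
      exact_mod_cast (hA.2.trans_le (hr v)).le
    linarith
  refine (expect_mono L h1 ∅).trans ?_
  rw [expect_sum_fun]
  refine (Finset.sum_le_sum h2).trans ?_
  have h5 : ∑ A : Finset V, Real.exp (-(κ / 2)) ^ A.card =
      (1 + Real.exp (-(κ / 2))) ^ Fintype.card V := by
    have := Fintype.sum_pow_mul_eq_add_pow V (Real.exp (-(κ / 2))) 1
    simpa [add_comm] using this
  rw [← h5, ← Finset.add_sum_erase _ _ (Finset.mem_univ (∅ : Finset V))]
  simp only [Finset.card_empty, pow_zero, add_sub_cancel_left]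
  refine Finset.sum_le_sum_of_subset_of_nonneg ?_ fun _ _ _ => by positivity
  intro A hA
  simp only [h𝒜, Finset.mem_filter, Finset.mem_univ, true_and] at hA
  simp [hA.1.ne_empty]

open scoped Classical in
/-- If there are no small closed sets to begin with, then there are so few closed sets that, after
further picks, every vertex lies in a component of at least half its degree. -/
theorem expect_exists_degree_gt_le (L : Multiset (PickLaw (Sym2 V))) {κ r : ℝ} (hκ : 0 ≤ κ)
    (hr : 0 < r) (hL : ∀ e ∈ G.edgeSet, ∀ v ∈ e, κ ≤ rate L e * G.degree v)
    {S : Finset (Sym2 V)}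
    (hS : ¬ ∃ A : Finset V, A.Nonempty ∧ 2 * (A.card : ℝ) < r ∧ IsClosedIn S A) :
    expect L (fun T => if ∃ v, 2 * (comp T v).card < G.degree v then 1 else 0) S ≤
      Fintype.card V * (Real.exp (2 * Fintype.card V / r) * Real.exp (-(κ / 2))) := by
  set 𝒞 : Finset (Finset V) := Finset.univ.filter (IsClosedIn S) with h𝒞
  set 𝒜 : V → Finset (Finset V) :=
    fun v => 𝒞.filter fun A => v ∈ A ∧ 2 * A.card < G.degree v with h𝒜
  have h0 : ∀ (T : Finset (Sym2 V)) (A : Finset V),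
      (0 : ℝ) ≤ if Disjoint T (edgeBoundary G A) then (1 : ℝ) else 0 :=
    fun T A => by split_ifs <;> norm_num
  have h1 : ∀ T, S ⊆ T → (if ∃ v, 2 * (comp T v).card < G.degree v then (1 : ℝ) else 0) ≤
      ∑ v, ∑ A ∈ 𝒜 v, if Disjoint T (edgeBoundary G A) then (1 : ℝ) else 0 := by
    intro T hST
    split_ifs with h
    · obtain ⟨v, hv⟩ := h
      have hmem : comp T v ∈ 𝒜 v := by
        simp [h𝒜, h𝒞, hv, self_mem_comp, (isClosedIn_comp T v).mono hST]
      have h2 := Finset.single_le_sum (fun A _ => h0 T A) hmem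
      rw [if_pos ((isClosedIn_comp T v).disjoint_edgeBoundary G)] at h2
      exact h2.trans (Finset.single_le_sum
        (f := fun v => ∑ A ∈ 𝒜 v, if Disjoint T (edgeBoundary G A) then (1 : ℝ) else 0)
        (fun v _ => Finset.sum_nonneg fun A _ => h0 T A) (Finset.mem_univ v))
    · exact Finset.sum_nonneg fun v _ => Finset.sum_nonneg fun A _ => h0 T A
  have h2 : ∀ v, ∀ A ∈ 𝒜 v,
      expect L (fun T => if Disjoint T (edgeBoundary G A) then (1 : ℝ) else 0) S ≤
        Real.exp (-(κ / 2)) := by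
    intro v A hA
    simp only [h𝒜, Finset.mem_filter] at hA
    refine (expect_disjoint_le L (edgeBoundary G A) S).trans ?_
    split_ifs
    · rw [Real.exp_le_exp]
      have h4 := le_sum_edgeBoundary G hκ (rate_nonneg L) hL
        (Finset.singleton_subset_iff.2 hA.2.1) fun w hw => by
          rw [Finset.mem_singleton.1 hw]; exact hA.2.2.le
      simp only [Finset.card_singleton, Nat.cast_one, mul_one] at h4
      linarith
    · positivity
  have hcard : (𝒞.card : ℝ) ≤ Real.exp (2 * Fintype.card V / r) := by
    obtain ⟨f, hf, -⟩ := exists_rank G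
    have h3 : ((leaders f S).card : ℝ) ≤ 2 * Fintype.card V / r := by
      rw [le_div_iff₀ hr, ← nsmul_eq_mul, ← Finset.sum_const]
      have h4 : ∀ v ∈ leaders f S, r ≤ 2 * ((comp S v).card : ℝ) := by
        intro v _
        by_contra! h
        exact hS ⟨comp S v, ⟨v, self_mem_comp S v⟩, h, isClosedIn_comp S v⟩
      refine (Finset.sum_le_sum h4).trans ?_
      rw [← Finset.mul_sum]
      have := sum_card_comp_leaders_le hf S
      exact mul_le_mul_of_nonneg_left (by exact_mod_cast this) zero_le_two
    calc (𝒞.card : ℝ) ≤ 2 ^ (leaders f S).card := by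
          exact_mod_cast card_isClosedIn_le (f := f) S
      _ ≤ Real.exp 1 ^ (leaders f S).card := by
          gcongr
          linarith [Real.add_one_le_exp 1]
      _ = Real.exp (leaders f S).card := by rw [← Real.exp_nat_mul, mul_one]
      _ ≤ _ := Real.exp_le_exp.2 h3
  refine (expect_mono_of_subset L h1).trans ?_
  rw [expect_sum_fun]
  simp only [expect_sum_fun]
  rw [← nsmul_eq_mul, ← Finset.card_univ, ← Finset.sum_const]
  refine Finset.sum_le_sum fun v _ => ?_
  refine (Finset.sum_le_card_nsmul _ _ _ (h2 v)).trans ?_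
  rw [nsmul_eq_mul]
  refine mul_le_mul_of_nonneg_right (le_trans ?_ hcard) (Real.exp_pos _).le
  exact_mod_cast Finset.card_le_card (Finset.filter_subset _ _)

open scoped Classical in
/-- If every vertex lies in a component of at least half its degree, then the potential is at most
twice the number of vertices, which bounds the expected number of crossing edges after further
picks. If the result is disconnected, there are at least `r` crossing edges. -/
theorem expect_not_connected_le_of_comp [Nonempty V] (L : Multiset (PickLaw (Sym2 V)))
    {κ r : ℝ} (hκ : 0 < κ) (hr : 0 < r)
    (hL : ∀ e ∈ G.edgeSet, ∀ v ∈ e, κ ≤ rate L e * G.degree v)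
    (hcut : ∀ A : Finset V, A.Nonempty → A ≠ Finset.univ → r ≤ (edgeBoundary G A).card)
    {S : Finset (Sym2 V)} (hS : ¬ ∃ v, 2 * (comp S v).card < G.degree v) :
    expect L (fun T => if (edgeGraph T).Connected then 0 else 1) S ≤
      2 * Fintype.card V / (κ * r) := by
  obtain ⟨f, hf, hfd⟩ := exists_rank G
  have hpot : potential G f S ≤ 2 * Fintype.card V := by
    push Not at hS
    have h1 : potential G f S ≤ ∑ v ∈ leaders f S, 2 * ((comp S v).card : ℝ) :=
      Finset.sum_le_sum fun v _ => by exact_mod_cast hS v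
    rw [← Finset.mul_sum] at h1
    have := sum_card_comp_leaders_le hf S
    exact h1.trans (mul_le_mul_of_nonneg_left (by exact_mod_cast this) zero_le_two)
  have hcross := expect_sum_crossing_le L G.edgeFinset (minDegreeOf G) (potential G f) Crosses
    (minDegreeOf_nonneg G) (potential_nonneg G f) (potential_antitone G f) crosses_antitone
    (fun e _ T he => potential_insert_add_le G hf hfd he) S
  have hQ0 : ∀ (e : Sym2 V) (T : Finset (Sym2 V)), (0 : ℝ) ≤ if Crosses e T then 1 else 0 :=
    fun e T => by split_ifs <;> norm_num
  have hrate : ∀ e ∈ G.edgeFinset, κ ≤ rate L e * minDegreeOf G e := by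
    intro e he
    rw [SimpleGraph.mem_edgeFinset] at he
    induction e with
    | _ u v =>
      have h1 : minDegreeOf G s(u, v) = min (G.degree u : ℝ) (G.degree v) := rfl
      rw [h1]
      rcases min_choice (G.degree u : ℝ) (G.degree v) with h | h <;> rw [h]
      · exact hL _ he u (Sym2.mem_mk_left u v)
      · exact hL _ he v (Sym2.mem_mk_right u v)
  have h1 : ∀ T : Finset (Sym2 V), r * (if (edgeGraph T).Connected then (0 : ℝ) else 1) ≤
      ∑ e ∈ G.edgeFinset, if Crosses e T then (1 : ℝ) else 0 := by
    intro T
    split_ifs with h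
    · rw [mul_zero]
      exact Finset.sum_nonneg fun e _ => hQ0 e T
    · obtain ⟨u, v, huv⟩ : ∃ u v, ¬ (edgeGraph T).Reachable u v := by
        by_contra! h'
        exact h ⟨h'⟩
      have hne : comp T u ≠ Finset.univ := fun h' =>
        huv (mem_comp.1 (h' ▸ Finset.mem_univ v))
      have h2 := hcut (comp T u) ⟨u, self_mem_comp T u⟩ hne
      have h3 : edgeBoundary G (comp T u) ⊆ G.edgeFinset.filter fun e => Crosses e T :=
        fun e he => Finset.mem_filter.2
          ⟨SimpleGraph.mem_edgeFinset.2 ((mem_edgeBoundary G).1 he).1,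
            crosses_of_mem_edgeBoundary G (isClosedIn_comp T u) he⟩
      rw [Finset.sum_boole, mul_one]
      exact h2.trans (by exact_mod_cast Finset.card_le_card h3)
  rw [le_div_iff₀ (by positivity)]
  calc expect L (fun T => if (edgeGraph T).Connected then 0 else 1) S * (κ * r)
      = κ * expect L (fun T => r * if (edgeGraph T).Connected then 0 else 1) S := by
        rw [expect_mul_fun]; ring
    _ ≤ κ * ∑ e ∈ G.edgeFinset, expect L (fun T => if Crosses e T then (1 : ℝ) else 0) S := by
        rw [← expect_sum_fun]
        exact mul_le_mul_of_nonneg_left (expect_mono L h1 S) hκ.le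
    _ ≤ ∑ e ∈ G.edgeFinset, rate L e * minDegreeOf G e *
          expect L (fun T => if Crosses e T then (1 : ℝ) else 0) S := by
        rw [Finset.mul_sum]
        exact Finset.sum_le_sum fun e he =>
          mul_le_mul_of_nonneg_right (hrate e he) (expect_nonneg L (hQ0 e) S)
    _ ≤ 2 * Fintype.card V := hcross.trans hpot

open scoped Classical in
/-- Three successive phases of picks make the graph connected. -/
theorem expect_not_connected_le [Nonempty V] (L₁ L₂ L₃ : Multiset (PickLaw (Sym2 V)))
    {κ r : ℝ} (hκ : 0 < κ) (hr : 0 < r)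
    (h₁ : ∀ e ∈ G.edgeSet, ∀ v ∈ e, κ ≤ rate L₁ e * G.degree v)
    (h₂ : ∀ e ∈ G.edgeSet, ∀ v ∈ e, κ ≤ rate L₂ e * G.degree v)
    (h₃ : ∀ e ∈ G.edgeSet, ∀ v ∈ e, κ ≤ rate L₃ e * G.degree v)
    (hdeg : ∀ v, r ≤ G.degree v)
    (hcut : ∀ A : Finset V, A.Nonempty → A ≠ Finset.univ → r ≤ (edgeBoundary G A).card) :
    expect (L₁ + L₂ + L₃) (fun T => if (edgeGraph T).Connected then 0 else 1) ∅ ≤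
      ((1 + Real.exp (-(κ / 2))) ^ Fintype.card V - 1) +
      Fintype.card V * (Real.exp (2 * Fintype.card V / r) * Real.exp (-(κ / 2))) +
      2 * Fintype.card V / (κ * r) := by
  set F : Finset (Sym2 V) → ℝ := fun T => if (edgeGraph T).Connected then 0 else 1
  set F₁ : Finset (Sym2 V) → ℝ := fun T =>
    if ∃ A : Finset V, A.Nonempty ∧ 2 * (A.card : ℝ) < r ∧ IsClosedIn T A then 1 else 0
  set F₂ : Finset (Sym2 V) → ℝ := fun T =>
    if ∃ v, 2 * (comp T v).card < G.degree v then 1 else 0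
  set δ₂ : ℝ := Fintype.card V * (Real.exp (2 * Fintype.card V / r) * Real.exp (-(κ / 2)))
  set δ₃ : ℝ := 2 * Fintype.card V / (κ * r)
  have hδ₂0 : 0 ≤ δ₂ := by positivity
  have hδ₃0 : 0 ≤ δ₃ := by positivity
  have hle : ∀ (L : Multiset (PickLaw (Sym2 V))) (H : Finset (Sym2 V) → ℝ),
      (∀ T, H T ≤ 1) → ∀ S, expect L H S ≤ 1 := fun L H hH S => by
    simpa [expect_const] using expect_mono L (G := fun _ => 1) hH S
  have e3 : ∀ S, expect L₃ F S ≤ δ₃ + F₂ S := by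
    intro S
    by_cases hS : ∃ v, 2 * (comp S v).card < G.degree v
    · have : F₂ S = 1 := if_pos hS
      rw [this]
      have := hle L₃ F (fun T => by dsimp only [F]; split_ifs <;> norm_num) S
      linarith
    · have : F₂ S = 0 := if_neg hS
      rw [this, add_zero]
      exact expect_not_connected_le_of_comp G L₃ hκ hr h₃ hcut hS
  have e2 : ∀ S, expect L₂ F₂ S ≤ δ₂ + F₁ S := by
    intro S
    by_cases hS : ∃ A : Finset V, A.Nonempty ∧ 2 * (A.card : ℝ) < r ∧ IsClosedIn S A
    · have : F₁ S = 1 := if_pos hS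
      rw [this]
      have := hle L₂ F₂ (fun T => by dsimp only [F₂]; split_ifs <;> norm_num) S
      linarith
    · have : F₁ S = 0 := if_neg hS
      rw [this, add_zero]
      exact expect_exists_degree_gt_le G L₂ hκ.le hr h₂ hS
  have e1 := expect_exists_small_le G L₁ hκ.le h₁ hdeg
  rw [expect_add, expect_add]
  calc expect L₁ (expect L₂ (expect L₃ F)) ∅
      ≤ expect L₁ (expect L₂ (fun S => δ₃ + F₂ S)) ∅ :=
        expect_mono L₁ (expect_mono L₂ e3) ∅
    _ ≤ expect L₁ (fun S => (δ₃ + δ₂) + F₁ S) ∅ := by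
        refine expect_mono L₁ (fun S => ?_) ∅
        rw [expect_add_fun, expect_const]
        linarith [e2 S]
    _ ≤ _ := by
        rw [expect_add_fun, expect_const]
        linarith

end Core

/-! ### Connectedness in the two models -/

section Models

/-- The failure probabilities of the three phases, with `κ = k / 4` and `r = c * n / k`, add up to
at most `1 / 16 + 1 / 32 + 1 / 8`. -/
theorem failure_bound_le_half {n c k : ℝ} (hn : 2 ≤ n) (hc : 64 ≤ c) (hk : 0 < k)
    (hkn : c * Real.log n ≤ k) {m : ℕ} (hm : (m : ℝ) = n) :
    ((1 + Real.exp (-(k / 4 / 2))) ^ m - 1) +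
      n * (Real.exp (2 * n / (c * n / k)) * Real.exp (-(k / 4 / 2))) +
      2 * n / (k / 4 * (c * n / k)) ≤ 1 / 2 := by
  have hn0 : 0 < n := by linarith
  have hc0 : 0 < c := by linarith
  have hlog : 0 ≤ Real.log n := Real.log_nonneg (by linarith)
  have hk64 : 64 * Real.log n ≤ k := (mul_le_mul_of_nonneg_right hc hlog).trans hkn
  set x := Real.exp (-(3 * k / 32)) with hx
  have hx0 : 0 < x := Real.exp_pos _
  have hxn : n * x ≤ 1 / 32 := by
    have h1 : x ≤ (n ^ 6)⁻¹ := by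
      have : (n ^ 6)⁻¹ = Real.exp (-(6 * Real.log n)) := by
        rw [Real.exp_neg, show (6 : ℝ) * Real.log n = (6 : ℕ) * Real.log n by norm_num,
          Real.exp_nat_mul, Real.exp_log hn0]
      rw [this, hx, Real.exp_le_exp]
      linarith
    have h2 : n * (n ^ 6)⁻¹ = (n ^ 5)⁻¹ := by field_simp
    have h3 : (2 : ℝ) ^ 5 ≤ n ^ 5 := pow_le_pow_left₀ (by norm_num) hn 5
    calc n * x ≤ n * (n ^ 6)⁻¹ := mul_le_mul_of_nonneg_left h1 hn0.le
      _ = (n ^ 5)⁻¹ := h2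
      _ ≤ (2 ^ 5)⁻¹ := inv_anti₀ (by norm_num) h3
      _ = 1 / 32 := by norm_num
  have e1 : (1 + Real.exp (-(k / 4 / 2))) ^ m - 1 ≤ 2 * (n * x) := by
    have h1 : Real.exp (-(k / 4 / 2)) ≤ x := Real.exp_le_exp.2 (by linarith)
    have h2 : (1 + Real.exp (-(k / 4 / 2))) ^ m ≤ Real.exp (n * x) := by
      rw [← hm, Real.exp_nat_mul]
      refine pow_le_pow_left₀ (by positivity) ?_ m
      linarith [Real.add_one_le_exp x]
    have h3 := Real.abs_exp_sub_one_le (x := n * x) (by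
      rw [abs_of_nonneg (by positivity)]; linarith)
    rw [abs_of_nonneg (by positivity : 0 ≤ n * x)] at h3
    linarith [le_abs_self (Real.exp (n * x) - 1)]
  have e2 : n * (Real.exp (2 * n / (c * n / k)) * Real.exp (-(k / 4 / 2))) ≤ n * x := by
    refine mul_le_mul_of_nonneg_left ?_ hn0.le
    rw [← Real.exp_add, hx, Real.exp_le_exp]
    have h1 : 2 * n / (c * n / k) = 2 * k / c := by field_simp
    have h2 : 2 * k / c ≤ k / 32 := by
      rw [div_le_div_iff₀ hc0 (by norm_num)]
      nlinarith
    linarith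
  have e3 : 2 * n / (k / 4 * (c * n / k)) ≤ 1 / 8 := by
    have h1 : 2 * n / (k / 4 * (c * n / k)) = 8 / c := by field_simp; norm_num
    rw [h1, div_le_div_iff₀ hc0 (by norm_num)]
    linarith
  linarith

variable {V : Type*} [Fintype V] [DecidableEq V] (G : SimpleGraph V) [DecidableRel G.Adj]

/-- A random graph whose independent coordinates dominate three phases of picks, each of rate at
least `k / (4 * deg v)` at every edge with an endpoint `v`, is connected with probability at least
`1 / 2`. -/
theorem half_le_measure_connected [Nontrivial V] {ι X : Type*} [Fintype ι] [MeasurableSpace X]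
    [Finite X] [MeasurableSingletonClass X] (μ : ι → Measure X) [∀ i, IsProbabilityMeasure (μ i)]
    (A : ι → X → Finset (Sym2 V)) (L₁ L₂ L₃ : ι → Multiset (PickLaw (Sym2 V)))
    (h : ∀ i (g : Finset (Sym2 V) → ℝ), Antitone g → (∀ S, 0 ≤ g S) → ∀ S,
      ∫⁻ x, ENNReal.ofReal (g (A i x ∪ S)) ∂μ i ≤
        ENNReal.ofReal (expect (L₁ i + L₂ i + L₃ i) g S))
    {c k : ℝ} (hc : 64 ≤ c) (hk : 0 < k) (hkn : c * Real.log (Fintype.card V) ≤ k)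
    (hG : G.IsEdgeConnected ⌈c * (Fintype.card V : ℝ) / k⌉₊)
    (h₁ : ∀ e ∈ G.edgeSet, ∀ v ∈ e, k / 4 ≤ rate (∑ i, L₁ i) e * G.degree v)
    (h₂ : ∀ e ∈ G.edgeSet, ∀ v ∈ e, k / 4 ≤ rate (∑ i, L₂ i) e * G.degree v)
    (h₃ : ∀ e ∈ G.edgeSet, ∀ v ∈ e, k / 4 ≤ rate (∑ i, L₃ i) e * G.degree v) :
    1 / 2 ≤ Measure.pi μ
      {ω | (edgeGraph (Finset.univ.biUnion fun i => A i (ω i))).Connected} := by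
  classical
  have hn : (2 : ℝ) ≤ Fintype.card V := by exact_mod_cast Fintype.one_lt_card
  have hr : 0 < c * (Fintype.card V : ℝ) / k := by positivity
  have hpick := expect_not_connected_le G (∑ i, L₁ i) (∑ i, L₂ i) (∑ i, L₃ i)
    (by positivity : 0 < k / 4) hr h₁ h₂ h₃
    (fun v => (Nat.le_ceil _).trans (by exact_mod_cast hG.le_degree))
    (fun B hB hB' => (Nat.le_ceil _).trans (by exact_mod_cast le_card_edgeBoundary G hG hB hB'))
  have hhalf := hpick.trans (failure_bound_le_half hn hc hk hkn rfl)
  rw [← Finset.sum_add_distrib, ← Finset.sum_add_distrib] at hhalf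
  set F : Finset (Sym2 V) → ℝ := fun T => if (edgeGraph T).Connected then 0 else 1
  have hFanti : Antitone F := by
    intro S T hST
    dsimp only [F]
    split_ifs with h1 h2
    · rfl
    · norm_num
    · exact absurd (SimpleGraph.Connected.mono (edgeGraph_mono hST) ‹_›) h1
    · rfl
  have hF0 : ∀ S, 0 ≤ F S := fun S => by dsimp only [F]; split_ifs <;> norm_num
  have hmain := (lintegral_pi_le_expect μ A _ h hFanti hF0).trans (ENNReal.ofReal_le_ofReal hhalf)
  set s : Set (ι → X) := {ω | (edgeGraph (Finset.univ.biUnion fun i => A i (ω i))).Connected}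
  have hs : MeasurableSet s := .of_discrete
  have hcompl : ∫⁻ ω, ENNReal.ofReal (F (Finset.univ.biUnion fun i => A i (ω i))) ∂Measure.pi μ =
      Measure.pi μ sᶜ := by
    rw [← lintegral_indicator_one hs.compl]
    refine lintegral_congr fun ω => ?_
    by_cases hω : ω ∈ s
    · have hval : F (Finset.univ.biUnion fun i => A i (ω i)) = 0 := if_pos hω
      rw [Set.indicator_of_notMem (by simpa using hω), hval, ENNReal.ofReal_zero]
    · have hval : F (Finset.univ.biUnion fun i => A i (ω i)) = 1 := if_neg hω
      rw [Set.indicator_of_mem (by simpa using hω), hval, ENNReal.ofReal_one, Pi.one_apply]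
  rw [hcompl] at hmain
  have h2 : (ENNReal.ofReal (1 / 2)) = 1 / 2 := by
    rw [ENNReal.ofReal_div_of_pos (by norm_num)]; simp
  rw [h2] at hmain
  have h3 : (1 : ℝ≥0∞) ≤ Measure.pi μ s + 1 / 2 :=
    (prob_add_prob_compl (μ := Measure.pi μ) hs).ge.trans (by gcongr)
  have h4 : (1 : ℝ≥0∞) - 1 / 2 = 1 / 2 := by
    rw [one_div, ENNReal.one_sub_inv_two]
  rw [← h4]
  exact tsub_le_iff_right.2 h3

theorem half_le_kOutMeasure [Nontrivial V] {c : ℝ} (hc : 64 ≤ c) {k : ℕ} (hk : 0 < k)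
    (hkn : c * Real.log (Fintype.card V) ≤ (k : ℝ))
    (hG : G.IsEdgeConnected ⌈c * (Fintype.card V : ℝ) / (k : ℝ)⌉₊) :
    1 / 2 ≤ kOutMeasure G k {ω | (kOutGraph ω).Connected} := by
  have hn : (2 : ℝ) ≤ Fintype.card V := by exact_mod_cast Fintype.one_lt_card
  have hk32 : 32 ≤ k := by
    have h1 : Real.log 2 ≤ Real.log (Fintype.card V) := Real.log_le_log (by norm_num) hn
    have h2 := Real.log_two_gt_d9
    have h3 : (64 : ℝ) * 0.5 ≤ c * Real.log (Fintype.card V) :=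
      mul_le_mul hc (by linarith) (by norm_num) (by linarith)
    have h4 : (32 : ℝ) ≤ k := by linarith
    exact_mod_cast h4
  have hrate : ∀ m : ℕ, k ≤ 4 * m → ∀ e ∈ G.edgeSet, ∀ v ∈ e, (k : ℝ) / 4 ≤
      rate (∑ i, m • {uniformPick (G.incidenceFinset i)}) e * G.degree v := by
    intro m hm e he v hv
    have hmem : e ∈ G.incidenceFinset v := by
      rw [SimpleGraph.mem_incidenceFinset]; exact ⟨he, hv⟩
    have hd : (0 : ℝ) < G.degree v := by
      rw [← SimpleGraph.card_incidenceFinset_eq_degree]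
      exact_mod_cast Finset.card_pos.2 ⟨e, hmem⟩
    have h1 := Finset.single_le_sum
      (fun i _ => (uniformPick (G.incidenceFinset i)).prob_nonneg e) (Finset.mem_univ v)
    have h2 : (uniformPick (G.incidenceFinset v)).prob e = (G.degree v : ℝ)⁻¹ := by
      simp only [uniformPick, if_pos hmem, SimpleGraph.card_incidenceFinset_eq_degree]
    rw [h2] at h1
    rw [rate_sum_nsmul]
    have hm' : (k : ℝ) ≤ 4 * m := by exact_mod_cast hm
    calc (k : ℝ) / 4 ≤ m := by linarith
      _ = m * (G.degree v : ℝ)⁻¹ * G.degree v := by field_simp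
      _ ≤ _ := by gcongr
  have hgraph : ∀ ω : V → Finset (Sym2 V),
      kOutGraph ω = edgeGraph (Finset.univ.biUnion fun i => id (ω i)) := by
    intro ω
    unfold kOutGraph edgeGraph
    congr 1
    ext e
    simp
  simp only [hgraph]
  -- The picks are split into three nearly equal parts; `k ≥ 32` makes each at least `k / 4`.
  refine half_le_measure_connected G _ (fun _ => id)
    (fun i => (k / 3) • {uniformPick (G.incidenceFinset i)})
    (fun i => (k / 3) • {uniformPick (G.incidenceFinset i)})
    (fun i => (k - 2 * (k / 3)) • {uniformPick (G.incidenceFinset i)})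
    ?_ hc (by exact_mod_cast hk) hkn hG (hrate _ (by omega)) (hrate _ (by omega))
    (hrate _ (by omega))
  intro v g hg hg0 S
  rw [← add_nsmul, ← add_nsmul, show k / 3 + k / 3 + (k - 2 * (k / 3)) = k by omega]
  exact lintegral_uniform_le_expect _ k
    (by rw [choices, SimpleGraph.card_incidenceFinset_eq_degree]) _ hg hg0 S

theorem half_le_expectedKOutMeasure [Nontrivial V] {c : ℝ} (hc : 64 ≤ c) {k : ℝ≥0} (hk : 0 < k)
    (hkn : c * Real.log (Fintype.card V) ≤ (k : ℝ))
    (hG : G.IsEdgeConnected ⌈c * (Fintype.card V : ℝ) / (k : ℝ)⌉₊) :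
    1 / 2 ≤ expectedKOutMeasure G k {ω | (expectedKOutGraph ω).Connected} := by
  have hk' : (0 : ℝ) < k := by exact_mod_cast hk
  -- A sample is replaced by `3 * R` picks; `R ≥ k` makes their probabilities at most `1`.
  obtain ⟨R, hR⟩ := exists_nat_ge (k : ℝ)
  have hR0 : (0 : ℝ) < R := hk'.trans_le hR
  have hd : ∀ d : G.Dart, (1 : ℝ) ≤ G.degree d.fst := fun d => by
    exact_mod_cast (SimpleGraph.degree_pos_iff_exists_adj _ _).2 ⟨d.snd, d.adj⟩
  obtain ⟨q, hq⟩ : ∃ q : G.Dart → ℝ, ∀ d, q d = k / (3 * R * G.degree d.fst) :=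
    ⟨_, fun _ => rfl⟩
  have hq0 : ∀ d, 0 ≤ q d := fun d => by rw [hq]; positivity
  have hq1 : ∀ d, q d ≤ 1 := by
    intro d
    have := hd d
    rw [hq]
    refine div_le_one_of_le₀ ?_ (by positivity)
    nlinarith
  have hgraph : ∀ ω : G.Dart → Bool, expectedKOutGraph ω =
      edgeGraph (Finset.univ.biUnion fun d => if ω d = true then {d.edge} else ∅) := by
    intro ω
    unfold expectedKOutGraph edgeGraph
    congr 1
    ext e
    rw [Finset.mem_coe, Finset.mem_biUnion]
    constructor
    · rintro ⟨d, hω, rfl⟩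
      exact ⟨d, Finset.mem_univ d, by simp [hω]⟩
    · rintro ⟨d, -, he⟩
      split_ifs at he with hω
      · exact ⟨d, hω, (Finset.mem_singleton.1 he).symm⟩
      · simp at he
  have hrate : ∀ e ∈ G.edgeSet, ∀ v ∈ e, (k : ℝ) / 4 ≤
      rate (∑ d : G.Dart, R • {singlePick d.edge (q d) (hq0 d) (hq1 d)}) e * G.degree v := by
    intro e he v hv
    obtain ⟨w, rfl⟩ := Sym2.mem_iff_exists.1 hv
    let d : G.Dart := ⟨(v, w), he⟩
    have hdpos : (0 : ℝ) < G.degree v := lt_of_lt_of_le one_pos (hd d)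
    have hqd : q d = k / (3 * R * G.degree v) := hq d
    have h1 := Finset.single_le_sum
      (fun d _ => (singlePick d.edge (q d) (hq0 d) (hq1 d)).prob_nonneg s(v, w))
      (Finset.mem_univ d)
    have h2 : (singlePick d.edge (q d) (hq0 d) (hq1 d)).prob s(v, w) = q d := if_pos rfl
    rw [h2] at h1
    rw [rate_sum_nsmul]
    calc (k : ℝ) / 4 ≤ k / 3 := by linarith
      _ = R * q d * G.degree v := by
        rw [hqd]
        field_simp
      _ ≤ _ := by gcongr
  simp only [hgraph]
  unfold expectedKOutMeasure
  refine half_le_measure_connected G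
    (fun d : G.Dart => ProbabilityTheory.bernoulliMeasure true false (sampleProb G k d.fst))
    (fun d b => if b = true then {d.edge} else ∅)
    (fun d => R • {singlePick d.edge (q d) (hq0 d) (hq1 d)})
    (fun d => R • {singlePick d.edge (q d) (hq0 d) (hq1 d)})
    (fun d => R • {singlePick d.edge (q d) (hq0 d) (hq1 d)})
    ?_ hc hk' hkn hG hrate hrate hrate
  intro d g hg hg0 S
  rw [← add_nsmul, ← add_nsmul]
  refine lintegral_bernoulli_le_expect d.edge (q d) (hq0 d) (hq1 d) _ _ ?_ hg hg0 S
  have hdpos := hd d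
  -- The union bound for the picks, and the trivial bound in case `deg d.fst < k`.
  have h1 : 1 - (1 - q d) ^ (R + R + R) ≤ k / G.degree d.fst := by
    have h2 := one_add_mul_le_pow (a := -q d) (by linarith [hq1 d]) (R + R + R)
    have h3 : ((R + R + R : ℕ) : ℝ) * q d = k / G.degree d.fst := by
      rw [hq]
      push_cast
      field_simp
      ring
    rw [← h3]
    rw [← sub_eq_add_neg] at h2
    linarith
  have h4 : 1 - (1 - q d) ^ (R + R + R) ≤ 1 := by
    have := pow_nonneg (sub_nonneg.2 (hq1 d)) (R + R + R)
    linarith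
  change _ ≤ (k : ℝ) / max (k : ℝ) (G.degree d.fst)
  rcases le_total (k : ℝ) (G.degree d.fst) with h | h
  · rwa [max_eq_right h]
  · rwa [max_eq_left h, div_self hk'.ne']

end Models

end RandomKOut

theorem corollary3 :
    ∃ c₀ : ℝ, 0 < c₀ ∧ ∀ c : ℝ, c₀ ≤ c →
      ∀ (V : Type*) [Fintype V] [DecidableEq V] [Nonempty V]
        (G : SimpleGraph V) [DecidableRel G.Adj],
        (∀ k : ℕ, 0 < k → c * Real.log (Fintype.card V) ≤ (k : ℝ) →
          G.IsEdgeConnected ⌈c * (Fintype.card V : ℝ) / (k : ℝ)⌉₊ →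
          1 / 2 ≤ RandomKOut.kOutMeasure G k {ω | (RandomKOut.kOutGraph ω).Connected}) ∧
        (∀ k : ℝ≥0, 0 < k → c * Real.log (Fintype.card V) ≤ (k : ℝ) →
          G.IsEdgeConnected ⌈c * (Fintype.card V : ℝ) / (k : ℝ)⌉₊ →
          1 / 2 ≤ RandomKOut.expectedKOutMeasure G k
            {ω | (RandomKOut.expectedKOutGraph ω).Connected}) := by
  refine ⟨64, by norm_num, fun c hc V _ _ _ G _ => ?_⟩
  cases subsingleton_or_nontrivial V with
  | inr _ =>
    exact ⟨fun k hk hkn hG => RandomKOut.half_le_kOutMeasure G hc hk hkn hG,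
      fun k hk hkn hG => RandomKOut.half_le_expectedKOutMeasure G hc hk hkn hG⟩
  | inl _ =>
    have hconn : ∀ H : SimpleGraph V, H.Connected := fun H => ⟨.of_subsingleton⟩
    have hhalf : (1 : ℝ≥0∞) / 2 ≤ 1 := ENNReal.half_le_self
    refine ⟨fun k _ _ _ => ?_, fun k _ _ _ => ?_⟩
    · simp only [hconn, Set.ofPred_true, RandomKOut.kOutMeasure, measure_univ]
      exact hhalf
    · simp only [hconn, Set.ofPred_true, RandomKOut.expectedKOutMeasure, measure_univ]
      exact hhalf
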